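/- Let $H$ be an infinite-dimensional complex Hilbert space. For a bounded linear operator $A$ on $H$, call $A$ Li-Yorke chaotic if there is $x\in H$ with $\limsup_{n\to\infty}\|A^n x\|>0$ (possibly $+\infty$) and $\liminf_{n\to\infty}\|A^n x\|=0$. For a bounded linear operator $T$ on $H$ put $S_{LY}(T)=\{\lambda\in\mathbb{C} : \lambda I+T \text{ is Li-Yorke chaotic}\}$. Then there is a bounded linear operator $T$ on $H$ such that $S_{LY}(T)$ is neither open nor closed in $\mathbb{C}$. -/

import Mathlib

open Filter

/-- `x` is a Li-Yorke chaotic point of the bounded operator `T`: the upper limit of `‖T ^ n x‖`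
is positive (possibly infinite) and its lower limit is zero.  The norms are taken with values in
`[0, ∞]`, where upper and lower limits of arbitrary sequences exist. -/
def IsLiYorkeChaoticPoint {E : Type*} [NormedAddCommGroup E] [NormedSpace ℂ E]
    (T : E →L[ℂ] E) (x : E) : Prop :=
  0 < limsup (fun n : ℕ => ‖(T ^ n) x‖ₑ) atTop ∧
    liminf (fun n : ℕ => ‖(T ^ n) x‖ₑ) atTop = 0

/-- A bounded operator is Li-Yorke chaotic if it has a Li-Yorke chaotic point. -/
def IsLiYorkeChaotic {E : Type*} [NormedAddCommGroup E] [NormedSpace ℂ E]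
    (T : E →L[ℂ] E) : Prop :=
  ∃ x : E, IsLiYorkeChaoticPoint T x

/-- `S_LY(T)`: the set of scalars `c` such that `c I + T` is Li-Yorke chaotic. -/
def liYorkeSet {E : Type*} [NormedAddCommGroup E] [NormedSpace ℂ E]
    (T : E →L[ℂ] E) : Set ℂ :=
  {c : ℂ | IsLiYorkeChaotic (c • ContinuousLinearMap.id ℂ E + T)}

/-!
Let `D` be a diagonal operator and `N` a square-zero operator commuting with `D`, so that
`(D + N) ^ (n + 1) = D ^ (n + 1) + (n + 1) • D ^ n * N`. If some eigenvalues of `D` of modulus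
less than `1` have modulus arbitrarily close to `1`, with eigenvectors which `N` does not shrink,
then `D + N` is unbounded in its powers on the vectors with orbit tending to zero. The Baire
category theorem in the closure of these vectors gives a Li-Yorke chaotic point. Conversely, if no
eigenvalue has modulus in `(r, 1)` for some `r < 1`, then a vector with small iterates has no
component where the modulus is at least `1`, and its whole orbit decays like `n * r ^ n`.

Hence `liYorkeSet (D + N)` consists of the `c` for which some eigenvalues `z` of `D` have
`‖c + z‖ < 1` with `‖c + z‖` arbitrarily close to `1`. With the eigenvalues dense in the ball of
radius `1 / 2` about `0` this is the half-open annulus `1 / 2 ≤ ‖c‖ < 3 / 2`.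
-/

open Topology Set
open scoped lp ENNReal

section Orbits

theorem liminf_enorm_eq_zero_iff {α F : Type*} [SeminormedAddCommGroup F] {l : Filter α}
    {u : α → F} :
    liminf (fun i => ‖u i‖ₑ) l = 0 ↔ ∀ ε > 0, ∃ᶠ i in l, ‖u i‖ < ε := by
  constructor
  · intro h ε hε
    have hlt : liminf (fun i => ‖u i‖ₑ) l < ENNReal.ofReal ε := by
      rwa [h, ENNReal.ofReal_pos]
    refine (frequently_lt_of_liminf_lt (h := hlt)).mono fun i hi => ?_
    rwa [← ofReal_norm, ENNReal.ofReal_lt_ofReal_iff hε] at hi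
  · intro h
    refine nonpos_iff_eq_zero.1 (ENNReal.le_of_forall_pos_le_add fun ε hε _ => ?_)
    rw [zero_add]
    refine liminf_le_of_frequently_le' ((h ε hε).mono fun i hi => ?_)
    rw [← ofReal_norm, ← ENNReal.ofReal_coe_nnreal]
    exact ENNReal.ofReal_le_ofReal hi.le

theorem limsup_enorm_eq_zero_iff {α F : Type*} [SeminormedAddCommGroup F] {l : Filter α}
    [l.NeBot] {u : α → F} :
    limsup (fun i => ‖u i‖ₑ) l = 0 ↔ Tendsto u l (𝓝 0) := by
  rw [tendsto_zero_iff_enorm_tendsto_zero]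
  exact ⟨fun h => tendsto_of_le_liminf_of_limsup_le bot_le h.le, Tendsto.limsup_eq⟩

variable {E : Type*} [NormedAddCommGroup E] [NormedSpace ℂ E] {A : E →L[ℂ] E} {x : E}

/-- The stable subspace of `A`: the vectors whose orbit under `A` tends to zero. -/
def stableSubspace (A : E →L[ℂ] E) : Submodule ℂ E where
  carrier := {x | Tendsto (fun n : ℕ => (A ^ n) x) atTop (𝓝 0)}
  zero_mem' := by simp
  add_mem' hx hy := by simpa using Tendsto.add hx hy
  smul_mem' c _ hx := by
    simpa only [mem_ofPred_eq, map_smul, smul_zero] using Tendsto.const_smul hx c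

theorem mem_stableSubspace :
    x ∈ stableSubspace A ↔ Tendsto (fun n : ℕ => (A ^ n) x) atTop (𝓝 0) :=
  Iff.rfl

theorem isLiYorkeChaoticPoint_iff :
    IsLiYorkeChaoticPoint A x ↔
      x ∉ stableSubspace A ∧ ∀ ε > 0, ∃ᶠ n : ℕ in atTop, ‖(A ^ n) x‖ < ε := by
  rw [IsLiYorkeChaoticPoint, pos_iff_ne_zero, Ne, limsup_enorm_eq_zero_iff,
    liminf_enorm_eq_zero_iff, mem_stableSubspace]

end Orbits

section BaireCategory

theorem eventually_residual_frequently_norm_lt {X F : Type*} [TopologicalSpace X]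
    [SeminormedAddCommGroup F] {L : ℕ → X → F} (hL : ∀ n, Continuous (L n))
    (hd : Dense {x | Tendsto (fun n => L n x) atTop (𝓝 0)}) :
    ∀ᶠ x in residual X, ∀ ε > 0, ∃ᶠ n in atTop, ‖L n x‖ < ε := by
  have hsmall : ∀ m : ℕ, ∀ᶠ x in residual X, ∃ n ≥ m, ‖L n x‖ < 1 / ((m : ℝ) + 1) := by
    intro m
    refine residual_of_dense_open ?_ (hd.mono fun x hx => ?_)
    · have hUnion : {x | ∃ n ≥ m, ‖L n x‖ < 1 / ((m : ℝ) + 1)} =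
          ⋃ n ≥ m, {x | ‖L n x‖ < 1 / ((m : ℝ) + 1)} := by
        ext
        simp
      change IsOpen {x | ∃ n ≥ m, ‖L n x‖ < 1 / ((m : ℝ) + 1)}
      rw [hUnion]
      exact isOpen_biUnion fun n _ => isOpen_lt (hL n).norm continuous_const
    · have hlt := (tendsto_zero_iff_norm_tendsto_zero.1 hx).eventually_lt_const
        (Nat.one_div_pos_of_nat (α := ℝ) (n := m))
      exact ((eventually_ge_atTop m).and hlt).exists
  filter_upwards [eventually_countable_forall.2 hsmall] with x hx ε hε
  refine frequently_atTop.2 fun N => ?_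
  obtain ⟨m, hm⟩ := exists_nat_one_div_lt hε
  obtain ⟨n, hn, hlt⟩ := hx (max m N)
  refine ⟨n, (le_max_right m N).trans hn, hlt.trans_le (le_trans ?_ hm.le)⟩
  exact Nat.one_div_le_one_div (le_max_left m N)

theorem isMeagre_setOf_forall_norm_le {𝕜 E F ι : Type*} [NontriviallyNormedField 𝕜]
    [NormedAddCommGroup E] [NormedSpace 𝕜 E] [CompleteSpace E] [SeminormedAddCommGroup F]
    [NormedSpace 𝕜 F] {L : ι → E →L[𝕜] F} (hL : ¬ ∃ C, ∀ i, ‖L i‖ ≤ C) :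
    IsMeagre {x | ∃ C, ∀ i, ‖L i x‖ ≤ C} := by
  let B : Submodule 𝕜 E :=
    { carrier := {x | ∃ C, ∀ i, ‖L i x‖ ≤ C}
      zero_mem' := ⟨0, by simp⟩
      add_mem' := by
        rintro x y ⟨C, hC⟩ ⟨C', hC'⟩
        exact ⟨C + C', fun i => by
          rw [map_add]
          exact norm_add_le_of_le (hC i) (hC' i)⟩
      smul_mem' := by
        rintro c x ⟨C, hC⟩
        exact ⟨‖c‖ * C, fun i => by
          rw [map_smul, norm_smul]
          exact mul_le_mul_of_nonneg_left (hC i) (norm_nonneg c)⟩ }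
  have hB : interior (B : Set E) = ∅ := by
    by_contra hne
    have htop := B.eq_top_of_nonempty_interior' (nonempty_iff_ne_empty.2 hne)
    exact hL (banach_steinhaus fun x => htop.ge (Submodule.mem_top (x := x)))
  have hnowhere : ∀ m : ℕ, IsNowhereDense {x | ∀ i, ‖L i x‖ ≤ m} := by
    intro m
    have hclosed : IsClosed {x | ∀ i, ‖L i x‖ ≤ m} := by
      simp only [ofPred_forall]
      exact isClosed_iInter fun i => isClosed_le (L i).continuous.norm continuous_const
    refine hclosed.isNowhereDense_iff.2 (subset_empty_iff.1 (hB ▸ interior_mono ?_))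
    exact fun x hx => ⟨m, hx⟩
  refine (isMeagre_iUnion fun m => (hnowhere m).isMeagre).mono ?_
  rintro x ⟨C, hC⟩
  obtain ⟨m, hm⟩ := exists_nat_ge C
  exact mem_iUnion.2 ⟨m, fun i => (hC i).trans hm⟩

theorem isLiYorkeChaotic_of_unbounded_on_stableSubspace {E : Type*} [NormedAddCommGroup E]
    [NormedSpace ℂ E] [CompleteSpace E] {A : E →L[ℂ] E}
    (hA : ∀ C : ℝ, ∃ x ∈ stableSubspace A, ∃ n : ℕ, C * ‖x‖ < ‖(A ^ n) x‖) :
    IsLiYorkeChaotic A := by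
  let M := (stableSubspace A).topologicalClosure
  let L : ℕ → M →L[ℂ] E := fun n => (A ^ n) ∘L M.subtypeL
  have : CompleteSpace M := (stableSubspace A).isClosed_topologicalClosure.completeSpace_coe
  have hsub : (stableSubspace A : Set E) ⊆
      Subtype.val '' {x : M | Tendsto (fun n => L n x) atTop (𝓝 0)} :=
    fun x hx => ⟨⟨x, (stableSubspace A).le_topologicalClosure hx⟩, hx, rfl⟩
  have hdense : Dense {x : M | Tendsto (fun n => L n x) atTop (𝓝 0)} :=
    Subtype.dense_iff.2 fun x hx => closure_mono hsub hx
  have hunbounded : ¬ ∃ C, ∀ n, ‖L n‖ ≤ C := by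
    rintro ⟨C, hC⟩
    obtain ⟨x, hx, n, hlt⟩ := hA C
    exact hlt.not_ge
      ((L n).le_of_opNorm_le (hC n) ⟨x, (stableSubspace A).le_topologicalClosure hx⟩)
  obtain ⟨x, hsmall, hlarge⟩ := (dense_of_mem_residual
    ((eventually_residual_frequently_norm_lt (fun n => (L n).continuous) hdense).and
      (isMeagre_setOf_forall_norm_le hunbounded))).nonempty
  refine ⟨x, isLiYorkeChaoticPoint_iff.2 ⟨fun hx => hlarge ?_, hsmall⟩⟩
  obtain ⟨C, hC⟩ := (mem_stableSubspace.1 hx).norm.bddAbove_range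
  exact ⟨C, fun n => hC (mem_range_self n)⟩

end BaireCategory

section SquareZeroPerturbation

theorem add_pow_succ_of_mul_self_eq_zero {R : Type*} [Semiring R] {a b : R} (hab : Commute a b)
    (hb : b * b = 0) (n : ℕ) :
    (a + b) ^ (n + 1) = a ^ (n + 1) + (n + 1) • (a ^ n * b) := by
  induction n with
  | zero => simp
  | succ n ih =>
    have hcomm : a ^ n * b * a = a ^ (n + 1) * b := by
      rw [mul_assoc, ← hab.eq, ← mul_assoc, pow_succ]
    have hzero : a ^ n * b * b = 0 := by rw [mul_assoc, hb, mul_zero]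
    rw [pow_succ, ih, add_mul, mul_add, smul_mul_assoc, mul_add, hcomm, hzero, add_zero,
      ← pow_succ, add_assoc, ← succ_nsmul']

variable {E : Type*} [NormedAddCommGroup E] [NormedSpace ℂ E] {D N : E →L[ℂ] E}

theorem add_pow_succ_apply (hDN : Commute D N) (hN : N * N = 0) (n : ℕ) (x : E) :
    ((D + N) ^ (n + 1)) x = (D ^ (n + 1)) x + (n + 1) • (D ^ n) (N x) := by
  rw [add_pow_succ_of_mul_self_eq_zero hDN hN]
  rfl

theorem mem_stableSubspace_add (hDN : Commute D N) (hN : N * N = 0) {r : ℝ} (hr₀ : 0 ≤ r)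
    (hr₁ : r < 1) {x : E} (hx : ∀ n : ℕ, ‖(D ^ n) x‖ ≤ r ^ n * ‖x‖)
    (hNx : ∀ n : ℕ, ‖(D ^ n) (N x)‖ ≤ r ^ n * ‖N x‖) :
    x ∈ stableSubspace (D + N) := by
  have hpow : Tendsto (fun n : ℕ => r ^ n) atTop (𝓝 0) :=
    tendsto_pow_atTop_nhds_zero_of_lt_one hr₀ hr₁
  have hmul : Tendsto (fun n : ℕ => (n + 1) * r ^ n) atTop (𝓝 0) := by
    simpa [add_mul] using (tendsto_self_mul_const_pow_of_lt_one hr₀ hr₁).add hpow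
  have hbound : Tendsto (fun n : ℕ => r ^ (n + 1) * ‖x‖ + (n + 1) * r ^ n * ‖N x‖) atTop (𝓝 0) := by
    simpa using ((hpow.comp (tendsto_add_atTop_nat 1)).mul_const ‖x‖).add (hmul.mul_const ‖N x‖)
  rw [mem_stableSubspace, ← tendsto_add_atTop_iff_nat 1]
  refine squeeze_zero_norm (fun n => ?_) hbound
  rw [add_pow_succ_apply hDN hN]
  refine norm_add_le_of_le (hx (n + 1)) ?_
  rw [← Nat.cast_smul_eq_nsmul ℝ, norm_smul, Real.norm_natCast, mul_assoc, Nat.cast_succ]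
  exact mul_le_mul_of_nonneg_left (hNx n) (by positivity)

theorem pow_apply_of_apply_eq_smul {z : ℂ} {e : E} (he : D e = z • e) (n : ℕ) :
    (D ^ n) e = z ^ n • e := by
  induction n with
  | zero => simp
  | succ n ih => rw [pow_succ, mul_apply_eq_comp, he, map_smul, ih, smul_smul, pow_succ']

theorem apply_eq_smul_of_commute (hDN : Commute D N) {z : ℂ} {e : E} (he : D e = z • e) :
    D (N e) = z • N e := by
  rw [← map_smul, ← he]
  exact DFunLike.congr_fun hDN.eq e

theorem eigenvector_mem_stableSubspace_add (hDN : Commute D N) (hN : N * N = 0) {z : ℂ}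
    (hz : ‖z‖ < 1) {e : E} (he : D e = z • e) : e ∈ stableSubspace (D + N) := by
  refine mem_stableSubspace_add hDN hN (norm_nonneg z) hz (fun n => ?_) (fun n => ?_)
  · rw [pow_apply_of_apply_eq_smul he, norm_smul, norm_pow]
  · rw [pow_apply_of_apply_eq_smul (apply_eq_smul_of_commute hDN he), norm_smul, norm_pow]

theorem isLiYorkeChaotic_add_of_eigenvectors [CompleteSpace E] (hDN : Commute D N)
    (hN : N * N = 0) {c : ℝ} (hc : 0 < c)
    (h : ∀ r < 1, ∃ z : ℂ, ∃ e : E,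
      r < ‖z‖ ∧ ‖z‖ < 1 ∧ D e = z • e ∧ e ≠ 0 ∧ c * ‖e‖ ≤ ‖N e‖) :
    IsLiYorkeChaotic (D + N) := by
  refine isLiYorkeChaotic_of_unbounded_on_stableSubspace fun C => ?_
  obtain ⟨n, hn⟩ := exists_nat_gt (2 * (C + 1) / c)
  obtain ⟨r, hr₁, hr⟩ : ∃ r < (1 : ℝ), Ioc r 1 ⊆ {t | 1 / 2 < t ^ n} :=
    exists_Ioc_subset_of_mem_nhds
      (((continuous_pow n).tendsto (1 : ℝ)).eventually_const_lt (by norm_num)) ⟨0, one_pos⟩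
  obtain ⟨z, e, hrz, hz, he, he0, hNe⟩ := h r hr₁
  refine ⟨e, eigenvector_mem_stableSubspace_add hDN hN hz he, n + 1, ?_⟩
  have he_pos : 0 < ‖e‖ := norm_pos_iff.2 he0
  have hpow : 1 / 2 < ‖z‖ ^ n := hr ⟨hrz, hz.le⟩
  have hDe : ‖(D ^ (n + 1)) e‖ ≤ ‖e‖ := by
    rw [pow_apply_of_apply_eq_smul he, norm_smul, norm_pow]
    exact mul_le_of_le_one_left he_pos.le (pow_le_one₀ (norm_nonneg z) hz.le)
  have hDNe : (C + 1) * ‖e‖ < ‖(n + 1) • (D ^ n) (N e)‖ := by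
    rw [pow_apply_of_apply_eq_smul (apply_eq_smul_of_commute hDN he),
      ← Nat.cast_smul_eq_nsmul ℝ, norm_smul, Real.norm_natCast, norm_smul, norm_pow]
    calc (C + 1) * ‖e‖ < n * (1 / 2 * (c * ‖e‖)) := by
          rw [div_lt_iff₀ hc] at hn
          nlinarith
      _ ≤ (n + 1 : ℕ) * (‖z‖ ^ n * ‖N e‖) := by
          gcongr
          exact n.le_succ
  rw [add_pow_succ_apply hDN hN, add_comm]
  linarith [norm_sub_le_norm_add ((n + 1) • (D ^ n) (N e)) ((D ^ (n + 1)) e)]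

end SquareZeroPerturbation

section DiagonalOperators

theorem eq_zero_of_frequently_norm_add_nsmul_lt {F : Type*} [NormedAddCommGroup F]
    [NormedSpace ℝ F] {u v : F} (h : ∀ ε > 0, ∃ᶠ n : ℕ in atTop, ‖u + n • v‖ < ε) :
    u = 0 ∧ v = 0 := by
  have hv : v = 0 := by
    by_contra hv
    have hlim : Tendsto (fun n : ℕ => n * ‖v‖ - ‖u‖) atTop atTop :=
      tendsto_atTop_add_const_right _ _
        (tendsto_natCast_atTop_atTop.atTop_mul_const (norm_pos_iff.2 hv))
    obtain ⟨n, hlt, hge⟩ := ((h 1 one_pos).and_eventually (hlim.eventually_ge_atTop 1)).exists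
    have hle := norm_sub_le_norm_add (n • v) u
    rw [← Nat.cast_smul_eq_nsmul ℝ, norm_smul, Real.norm_natCast, Nat.cast_smul_eq_nsmul,
      add_comm] at hle
    linarith
  subst hv
  refine ⟨norm_le_zero_iff.1 (le_of_forall_gt fun ε hε => ?_), rfl⟩
  simpa using (h ε hε).exists

variable {𝕜 ι H : Type*} [RCLike 𝕜] [NormedAddCommGroup H] [InnerProductSpace 𝕜 H]

theorem norm_le_mul_of_forall_norm_repr_le (b : HilbertBasis ι 𝕜 H) {x y : H} {C : ℝ}
    (hC : 0 ≤ C) (h : ∀ i, ‖b.repr y i‖ ≤ C * ‖b.repr x i‖) : ‖y‖ ≤ C * ‖x‖ := by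
  have hle : ‖b.repr y‖ ≤ ‖(C : 𝕜) • b.repr x‖ := by
    refine lp.norm_mono two_ne_zero fun i => (h i).trans_eq ?_
    rw [lp.coeFn_smul, Pi.smul_apply, norm_smul, RCLike.norm_of_nonneg hC]
  rwa [norm_smul, RCLike.norm_of_nonneg hC, b.repr.norm_map, b.repr.norm_map] at hle

theorem eq_of_forall_repr_eq (b : HilbertBasis ι 𝕜 H) {x y : H}
    (h : ∀ i, b.repr x i = b.repr y i) : x = y :=
  b.repr.injective (lp.ext (funext h))

/-- The diagonal operator in the Hilbert basis `b` with the bounded family of eigenvalues `d`. -/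
noncomputable def diagonalOperator (b : HilbertBasis ι 𝕜 H) (d : ℓ^∞(ι, 𝕜)) : H →L[𝕜] H :=
  (b.repr.symm : ℓ²(ι, 𝕜) →L[𝕜] H) ∘L
    lp.mapCLM 2 (fun i => d i • ContinuousLinearMap.id 𝕜 𝕜) (norm_nonneg d)
      (fun i => by simpa [norm_smul] using lp.norm_apply_le_norm ENNReal.top_ne_zero d i) ∘L
    (b.repr : H →L[𝕜] ℓ²(ι, 𝕜))

variable (b : HilbertBasis ι 𝕜 H) (d : ℓ^∞(ι, 𝕜))

theorem repr_diagonalOperator (x : H) (i : ι) :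
    b.repr (diagonalOperator b d x) i = d i * b.repr x i := by
  simp [diagonalOperator]

theorem repr_diagonalOperator_pow (n : ℕ) (x : H) (i : ι) :
    b.repr ((diagonalOperator b d ^ n) x) i = d i ^ n * b.repr x i := by
  induction n with
  | zero => simp
  | succ n ih =>
    rw [pow_succ', mul_apply_eq_comp, repr_diagonalOperator, ih, pow_succ', mul_assoc]

theorem diagonalOperator_apply_basis (i : ι) : diagonalOperator b d (b i) = d i • b i := by
  classical
  refine eq_of_forall_repr_eq b fun j => ?_
  rw [repr_diagonalOperator, map_smul, lp.coeFn_smul, Pi.smul_apply, b.repr_self, smul_eq_mul]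
  rcases eq_or_ne j i with rfl | hj
  · rfl
  · rw [lp.single_apply_ne _ _ _ hj, mul_zero, mul_zero]

theorem smul_one_add_apply (c : 𝕜) (i : ι) : (c • (1 : ℓ^∞(ι, 𝕜)) + d) i = c + d i := by
  rw [lp.coeFn_add, Pi.add_apply, lp.coeFn_smul, Pi.smul_apply, lp.infty_coeFn_one, Pi.one_apply,
    smul_eq_mul, mul_one]

theorem smul_id_add_diagonalOperator (c : 𝕜) :
    c • ContinuousLinearMap.id 𝕜 H + diagonalOperator b d =
      diagonalOperator b (c • (1 : ℓ^∞(ι, 𝕜)) + d) := by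
  ext x
  refine eq_of_forall_repr_eq b fun i => ?_
  rw [repr_diagonalOperator, smul_one_add_apply, add_mul, ← repr_diagonalOperator, add_apply,
    map_add, lp.coeFn_add, Pi.add_apply]
  simp

theorem norm_diagonalOperator_pow_apply_le {r : ℝ} (hr : 0 ≤ r) {x : H}
    (hx : ∀ i, ‖d i‖ ≤ r ∨ b.repr x i = 0) (n : ℕ) :
    ‖(diagonalOperator b d ^ n) x‖ ≤ r ^ n * ‖x‖ := by
  refine norm_le_mul_of_forall_norm_repr_le b (pow_nonneg hr n) fun i => ?_
  rw [repr_diagonalOperator_pow, norm_mul, norm_pow]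
  rcases hx i with hi | hi
  · gcongr
  · simp [hi]

end DiagonalOperators

section SpectralGap

variable {ι H : Type*} [NormedAddCommGroup H] [InnerProductSpace ℂ H]
  {b : HilbertBasis ι ℂ H} {d : ℓ^∞(ι, ℂ)} {N : H →L[ℂ] H}

theorem repr_eq_zero_of_frequently_norm_lt (hDN : Commute (diagonalOperator b d) N)
    (hN : N * N = 0) {x : H}
    (hx : ∀ ε > 0, ∃ᶠ n : ℕ in atTop, ‖((diagonalOperator b d + N) ^ n) x‖ < ε) {i : ι}
    (hi : 1 ≤ ‖d i‖) : b.repr x i = 0 ∧ b.repr (N x) i = 0 := by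
  suffices h : d i * b.repr x i = 0 ∧ b.repr (N x) i = 0 from
    ⟨(mul_eq_zero.1 h.1).resolve_left (norm_pos_iff.1 (one_pos.trans_le hi)), h.2⟩
  refine eq_zero_of_frequently_norm_add_nsmul_lt fun ε hε => ?_
  refine ((hx ε hε).and_eventually (eventually_ge_atTop 1)).mono ?_
  rintro (_ | n) ⟨hlt, hn⟩
  · exact absurd hn (by norm_num)
  have hcoord : b.repr (((diagonalOperator b d + N) ^ (n + 1)) x) i =
      d i ^ n * (d i * b.repr x i + (n + 1) • b.repr (N x) i) := by
    rw [add_pow_succ_apply hDN hN, map_add, map_nsmul, lp.coeFn_add, Pi.add_apply,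
      ← Nat.cast_smul_eq_nsmul ℂ, lp.coeFn_smul, Pi.smul_apply, repr_diagonalOperator_pow,
      repr_diagonalOperator_pow, ← Nat.cast_smul_eq_nsmul ℂ, smul_eq_mul, smul_eq_mul]
    ring
  calc ‖d i * b.repr x i + (n + 1) • b.repr (N x) i‖
      ≤ ‖d i‖ ^ n * ‖d i * b.repr x i + (n + 1) • b.repr (N x) i‖ :=
        le_mul_of_one_le_left (norm_nonneg _) (one_le_pow₀ hi)
    _ = ‖b.repr (((diagonalOperator b d + N) ^ (n + 1)) x) i‖ := by
        rw [hcoord, norm_mul, norm_pow]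
    _ ≤ ‖((diagonalOperator b d + N) ^ (n + 1)) x‖ :=
        (lp.norm_apply_le_norm two_ne_zero _ i).trans_eq (b.repr.norm_map _)
    _ < ε := hlt

theorem not_isLiYorkeChaotic_diagonalOperator_add (hDN : Commute (diagonalOperator b d) N)
    (hN : N * N = 0) {r : ℝ} (hr₀ : 0 ≤ r) (hr₁ : r < 1) (hgap : ∀ i, ‖d i‖ ≤ r ∨ 1 ≤ ‖d i‖) :
    ¬ IsLiYorkeChaotic (diagonalOperator b d + N) := by
  rintro ⟨x, hx⟩
  obtain ⟨hunstable, hsmall⟩ := isLiYorkeChaoticPoint_iff.1 hx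
  have hzero {i : ι} (hi : 1 ≤ ‖d i‖) := repr_eq_zero_of_frequently_norm_lt hDN hN hsmall hi
  exact hunstable (mem_stableSubspace_add hDN hN hr₀ hr₁
    (norm_diagonalOperator_pow_apply_le b d hr₀ fun i => (hgap i).imp_right fun hi => (hzero hi).1)
    (norm_diagonalOperator_pow_apply_le b d hr₀ fun i => (hgap i).imp_right fun hi => (hzero hi).2))

end SpectralGap

section JordanBlocks

variable {𝕜 ι κ H : Type*} [RCLike 𝕜] [NormedAddCommGroup H] [InnerProductSpace 𝕜 H]
  [CompleteSpace H]

/-- The Hilbert basis `b` reindexed along the bijection `e`. -/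
noncomputable def hilbertBasisReindex (b : HilbertBasis ι 𝕜 H) (e : κ ≃ ι) :
    HilbertBasis κ 𝕜 H :=
  HilbertBasis.mk (b.orthonormal.comp e e.injective) (by
    rw [e.surjective.range_comp, b.dense_span])

theorem repr_hilbertBasisReindex (b : HilbertBasis ι 𝕜 H) (e : κ ≃ ι) (x : H) (k : κ) :
    (hilbertBasisReindex b e).repr x k = b.repr x (e k) := by
  rw [HilbertBasis.repr_apply_apply, HilbertBasis.repr_apply_apply, hilbertBasisReindex,
    HilbertBasis.coe_mk, Function.comp_apply]

theorem exists_hilbertBasis_prod_bool (hH : ¬ FiniteDimensional 𝕜 H) :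
    ∃ κ : Set H, Infinite κ ∧ Nonempty (HilbertBasis (κ × Bool) 𝕜 H) := by
  obtain ⟨κ, b, -⟩ := exists_hilbertBasis 𝕜 H
  have hκ : Infinite κ := by
    by_contra hfin
    rw [not_infinite_iff_finite] at hfin
    have := Fintype.ofFinite κ
    exact hH b.toOrthonormalBasis.toBasis.finiteDimensional_of_finite
  have hcard : Cardinal.mk (κ × Bool) = Cardinal.mk κ := by
    rw [Cardinal.mk_prod, Cardinal.lift_uzero, Cardinal.mk_bool, Cardinal.lift_ofNat]
    exact Cardinal.mul_eq_left (Cardinal.aleph0_le_mk κ)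
      (Cardinal.ofNat_lt_aleph0.le.trans (Cardinal.aleph0_le_mk κ)) two_ne_zero
  obtain ⟨e⟩ := Cardinal.eq.1 hcard
  exact ⟨κ, hκ, ⟨hilbertBasisReindex b e⟩⟩

/-- The square-zero partial isometry sending `b (k, true)` to `b (k, false)` and `b (k, false)`
to `0`. It is encoded as the interchange of the two vectors of each pair followed by the projection
onto the span of the `b (k, false)`. -/
noncomputable def pairShift (b : HilbertBasis (κ × Bool) 𝕜 H) : H →L[𝕜] H :=
  diagonalOperator b
      ⟨fun i => if i.2 then 0 else 1, memℓp_infty ⟨1, by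
        rintro _ ⟨i, rfl⟩
        dsimp only
        split_ifs <;> simp⟩⟩ ∘L
    ((hilbertBasisReindex b ((Equiv.refl κ).prodCongr Equiv.boolNot)).repr.trans b.repr.symm :
      H →L[𝕜] H)

variable (b : HilbertBasis (κ × Bool) 𝕜 H)

theorem repr_pairShift_true (x : H) (k : κ) : b.repr (pairShift b x) (k, true) = 0 := by
  simp [pairShift, repr_diagonalOperator]

theorem repr_pairShift_false (x : H) (k : κ) :
    b.repr (pairShift b x) (k, false) = b.repr x (k, true) := by
  simp [pairShift, repr_diagonalOperator, repr_hilbertBasisReindex]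

theorem pairShift_mul_self : pairShift b * pairShift b = 0 := by
  ext x
  refine eq_of_forall_repr_eq b ?_
  rintro ⟨k, _ | _⟩ <;> simp [repr_pairShift_true, repr_pairShift_false]

theorem commute_diagonalOperator_pairShift {d : ℓ^∞(κ × Bool, 𝕜)}
    (hd : ∀ k, d (k, true) = d (k, false)) : Commute (diagonalOperator b d) (pairShift b) := by
  ext x
  refine eq_of_forall_repr_eq b ?_
  rintro ⟨k, _ | _⟩ <;>
    simp [repr_diagonalOperator, repr_pairShift_true, repr_pairShift_false, hd]

theorem pairShift_apply_basis_true (k : κ) : pairShift b (b (k, true)) = b (k, false) := by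
  classical
  refine eq_of_forall_repr_eq b ?_
  rintro ⟨l, _ | _⟩
  · rw [repr_pairShift_false, b.repr_self, b.repr_self]
    simp [Pi.single_apply]
  · rw [repr_pairShift_true, b.repr_self]
    simp

end JordanBlocks

section JordanBlockSpectrum

variable {κ H : Type*} [NormedAddCommGroup H] [InnerProductSpace ℂ H] [CompleteSpace H]

theorem mem_liYorkeSet_diagonalOperator_add_pairShift (b : HilbertBasis (κ × Bool) ℂ H)
    {d : ℓ^∞(κ × Bool, ℂ)} (hd : ∀ k, d (k, true) = d (k, false)) {c : ℂ} :
    c ∈ liYorkeSet (diagonalOperator b d + pairShift b) ↔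
      ∀ r < 1, ∃ k, r < ‖c + d (k, true)‖ ∧ ‖c + d (k, true)‖ < 1 := by
  have hcomm := commute_diagonalOperator_pairShift b (d := c • 1 + d) fun k => by
    rw [smul_one_add_apply, smul_one_add_apply, hd]
  have hsq := pairShift_mul_self b
  change IsLiYorkeChaotic _ ↔ _
  rw [← add_assoc, smul_id_add_diagonalOperator]
  refine ⟨fun hchaos => ?_, fun h => ?_⟩
  · by_contra! hgap
    obtain ⟨r, hr, hgap⟩ := hgap
    refine not_isLiYorkeChaotic_diagonalOperator_add hcomm hsq (le_max_right r 0)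
      (max_lt hr one_pos) ?_ hchaos
    have hpair (k : κ) : ‖c + d (k, true)‖ ≤ max r 0 ∨ 1 ≤ ‖c + d (k, true)‖ :=
      (le_or_gt _ r).imp le_sup_of_le_left (hgap k)
    rintro ⟨k, _ | _⟩
    · rw [smul_one_add_apply, ← hd]
      exact hpair k
    · rw [smul_one_add_apply]
      exact hpair k
  · refine isLiYorkeChaotic_add_of_eigenvectors hcomm hsq one_pos fun r hr => ?_
    obtain ⟨k, hk⟩ := h r hr
    refine ⟨c + d (k, true), b (k, true), hk.1, hk.2, ?_, b.orthonormal.ne_zero _, ?_⟩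
    · rw [diagonalOperator_apply_basis, smul_one_add_apply]
    · rw [pairShift_apply_basis_true, b.orthonormal.1, b.orthonormal.1, one_mul]

theorem exists_liYorkeSet_eq (hH : ¬ FiniteDimensional ℂ H) {Λ : Set ℂ} (hne : Λ.Nonempty)
    (hΛ : Bornology.IsBounded Λ) :
    ∃ T : H →L[ℂ] H, liYorkeSet T = {c | ∀ r < 1, ∃ z ∈ Λ, r < ‖c + z‖ ∧ ‖c + z‖ < 1} := by
  obtain ⟨κ, hκ, ⟨b⟩⟩ := exists_hilbertBasis_prod_bool hH
  have := hne.to_subtype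
  obtain ⟨index, hindex⟩ : ∃ f : κ → ℕ, f.Surjective :=
    ⟨_, Function.invFun_surjective (Infinite.natEmbedding κ).injective⟩
  have hdense : DenseRange (TopologicalSpace.denseSeq Λ ∘ index) := by
    rw [DenseRange, hindex.range_comp]
    exact TopologicalSpace.denseRange_denseSeq Λ
  obtain ⟨C, hC⟩ := hΛ.exists_norm_le
  let d : ℓ^∞(κ × Bool, ℂ) := ⟨fun i => TopologicalSpace.denseSeq Λ (index i.1),
    memℓp_infty ⟨C, by
      rintro _ ⟨i, rfl⟩
      exact hC _ (Subtype.coe_prop _)⟩⟩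
  refine ⟨diagonalOperator b d + pairShift b, ext fun c => ?_⟩
  rw [mem_liYorkeSet_diagonalOperator_add_pairShift b (d := d) fun k => rfl]
  refine forall₂_congr fun r _ => ⟨fun ⟨k, hk⟩ => ⟨_, Subtype.coe_prop _, hk⟩, ?_⟩
  rintro ⟨z, hz, hrz⟩
  have hcont : Continuous fun w : Λ => ‖c + w‖ := by fun_prop
  exact hdense.exists_mem_open (isOpen_Ioo.preimage hcont) ⟨⟨z, hz⟩, hrz⟩

end JordanBlockSpectrum

section Annulus

variable {E : Type*} [NormedAddCommGroup E] [NormedSpace ℝ E]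

theorem forall_lt_one_exists_mem_ball_iff {R : ℝ} (hR : R < 1) {c : E} :
    (∀ r < 1, ∃ z ∈ Metric.ball (0 : E) R, r < ‖c + z‖ ∧ ‖c + z‖ < 1) ↔
      ‖c‖ ∈ Ico (1 - R) (1 + R) := by
  simp only [mem_ball_zero_iff]
  constructor
  · intro h
    constructor
    · by_contra! hlt
      obtain ⟨z, hz, hcz, -⟩ := h (‖c‖ + R) (by linarith)
      linarith [norm_add_le c z]
    · obtain ⟨z, hz, -, hcz⟩ := h 0 one_pos
      linarith [norm_le_add_norm_add c z]
  · rintro ⟨hle, hlt⟩ r hr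
    have hc : 0 < ‖c‖ := by linarith
    obtain ⟨t, ht, ht₁⟩ : ∃ t, max (max r 0) (‖c‖ - R) < t ∧ t < 1 :=
      exists_between (max_lt (max_lt hr one_pos) (by linarith))
    simp only [max_lt_iff] at ht
    obtain ⟨⟨hrt, ht₀⟩, hct⟩ := ht
    have hnorm : ‖(t / ‖c‖) • c‖ = t := by
      rw [norm_smul, norm_div, norm_norm, div_mul_cancel₀ _ hc.ne', Real.norm_of_nonneg ht₀.le]
    refine ⟨(t / ‖c‖) • c - c, ?_, ?_⟩
    · have hdist : ‖(t / ‖c‖) • c - c‖ = |t - ‖c‖| := by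
        have hsub : (t / ‖c‖) • c - c = ((t - ‖c‖) / ‖c‖) • c := by
          rw [sub_div, div_self hc.ne', sub_smul, one_smul]
        rw [hsub, norm_smul, norm_div, norm_norm, div_mul_cancel₀ _ hc.ne', Real.norm_eq_abs]
      rw [hdist, abs_lt]
      constructor <;> linarith
    · rw [add_sub_cancel, hnorm]
      exact ⟨hrt, ht₁⟩

variable [Nontrivial E]

theorem not_isClosed_ball (x : E) {r : ℝ} (hr : 0 < r) : ¬ IsClosed (Metric.ball x r) := by
  intro hclosed
  have hfrontier := IsClopen.frontier_eq ⟨hclosed, Metric.isOpen_ball⟩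
  rw [frontier_ball x hr.ne'] at hfrontier
  exact (NormedSpace.sphere_nonempty.2 hr.le).ne_empty hfrontier

theorem not_isOpen_setOf_norm_mem_Ico {a b : ℝ} (ha : 0 < a) (hab : a < b) :
    ¬ IsOpen {c : E | ‖c‖ ∈ Ico a b} := by
  intro hopen
  have hunion : (Metric.ball (0 : E) a)ᶜ = {c | ‖c‖ ∈ Ico a b} ∪ (Metric.closedBall 0 a)ᶜ := by
    ext c
    simp only [mem_compl_iff, mem_ball_zero_iff, mem_union, mem_closedBall_zero_iff, mem_ofPred_eq,
      mem_Ico]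
    grind
  refine not_isClosed_ball (0 : E) ha ⟨?_⟩
  rw [hunion]
  exact hopen.union Metric.isClosed_closedBall.isOpen_compl

theorem not_isClosed_setOf_norm_mem_Ico {a b : ℝ} (hb : 0 < b) (hab : a < b) :
    ¬ IsClosed {c : E | ‖c‖ ∈ Ico a b} := by
  intro hclosed
  have hunion : Metric.ball (0 : E) b = {c | ‖c‖ ∈ Ico a b} ∪ Metric.closedBall 0 a := by
    ext c
    simp only [mem_ball_zero_iff, mem_union, mem_closedBall_zero_iff, mem_ofPred_eq, mem_Ico]
    grind
  refine not_isClosed_ball (0 : E) hb ?_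
  rw [hunion]
  exact hclosed.union Metric.isClosed_closedBall

end Annulus

theorem theorem12 {H : Type*} [NormedAddCommGroup H] [InnerProductSpace ℂ H] [CompleteSpace H]
    (hH : ¬ FiniteDimensional ℂ H) :
    ∃ T : H →L[ℂ] H, ¬ IsOpen (liYorkeSet T) ∧ ¬ IsClosed (liYorkeSet T) := by
  obtain ⟨T, hT⟩ := exists_liYorkeSet_eq hH (Λ := Metric.ball 0 (1 / 2))
    (Metric.nonempty_ball.2 one_half_pos) Metric.isBounded_ball
  have hannulus : liYorkeSet T = {c | ‖c‖ ∈ Ico (1 - 1 / 2 : ℝ) (1 + 1 / 2)} :=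
    hT.trans (ext fun c => forall_lt_one_exists_mem_ball_iff one_half_lt_one)
  refine ⟨T, ?_⟩
  rw [hannulus]
  exact ⟨not_isOpen_setOf_norm_mem_Ico (by norm_num) (by norm_num),
    not_isClosed_setOf_norm_mem_Ico (by norm_num) (by norm_num)⟩
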